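/- Let $d\in\mathbb{N}$, let $C:\mathbb{R}^d\times\mathbb{R}^d\to\mathbb{C}$ and $C_0:\mathbb{R}^d\to\mathbb{C}$ satisfy $C(x,y)=C_0(x-y)$ for all $x,y\in\mathbb{R}^d$. Consider the following conditions. (C1) $C$ is a continuous complex covariance function, i.e. $C$ is continuous and for all $n$ and all $x_1,\dots,x_n\in\mathbb{R}^d$ the matrix $(C(x_i,x_j))_{i,j=1}^n$ is Hermitian and positive semidefinite. (C2) For every compact set $S\subset\mathbb{R}^d$, every eigenvalue $\lambda$ of the integral operator $h\mapsto\int_S C(\cdot,y)\,h(y)\,\mathrm{d}y$ on $L^2(S)$ satisfies $\lambda\le 1$ (under (C1) these eigenvalues are real). Then the following two statements are equivalent. (i) There exists $\varphi\in L^1(\mathbb{R}^d)$ with $0\le\varphi\le 1$ and $C_0=\mathcal{F}^{-1}(\varphi)$, i.e. $C_0(x)=\int_{\mathbb{R}^d}\varphi(y)\,\mathrm{e}^{2\pi\mathrm{i}\,x\cdot y}\,\mathrm{d}y$ for all $x\in\mathbb{R}^d$. (ii) Conditions (C1) and (C2) hold and $C_0\in L^2(\mathbb{R}^d)$. -/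

import Mathlib

open MeasureTheory
open scoped FourierTransform ComplexOrder

namespace DPP

/-- The `n × n` matrix `[C](x₁, …, xₙ)` with entries `C(xᵢ, xⱼ)`. -/
def kernelMatrix {E : Type*} (C : E → E → ℂ) {n : ℕ} (x : Fin n → E) :
    Matrix (Fin n) (Fin n) ℂ :=
  Matrix.of fun i j => C (x i) (x j)

/-- A complex covariance function: a Hermitian, non-negative definite kernel
(`Matrix.PosSemidef` includes being Hermitian). -/
def IsCovarianceFunction {E : Type*} (C : E → E → ℂ) : Prop :=
  ∀ (n : ℕ) (x : Fin n → E), (kernelMatrix C x).PosSemidef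

/-- Condition (C1): `C` is a continuous complex covariance function. -/
def CondC1 {d : ℕ} (C : EuclideanSpace ℝ (Fin d) → EuclideanSpace ℝ (Fin d) → ℂ) : Prop :=
  Continuous (fun p : EuclideanSpace ℝ (Fin d) × EuclideanSpace ℝ (Fin d) => C p.1 p.2) ∧
    IsCovarianceFunction C

/-- `c` is an eigenvalue of the integral operator `h ↦ ∫_S C(·, y) h(y) dy` on `L²(S)`:
there is an eigenfunction `h ∈ L²(S)`, not almost everywhere zero on `S`. -/
def IsKernelEigenvalue {d : ℕ} (C : EuclideanSpace ℝ (Fin d) → EuclideanSpace ℝ (Fin d) → ℂ)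
    (S : Set (EuclideanSpace ℝ (Fin d))) (c : ℂ) : Prop :=
  ∃ h : EuclideanSpace ℝ (Fin d) → ℂ,
    MemLp h 2 (volume.restrict S) ∧
    ¬ (∀ᵐ x ∂(volume.restrict S), h x = 0) ∧
    ∀ᵐ x ∂(volume.restrict S), ∫ y in S, C x y * h y = c * h x

/-- Condition (C2): for every compact `S`, all eigenvalues of the kernel `C` on `S` are at most
one. (Under (C1) the integral operator is self-adjoint, so all its eigenvalues are real.) -/
def CondC2 {d : ℕ} (C : EuclideanSpace ℝ (Fin d) → EuclideanSpace ℝ (Fin d) → ℂ) : Prop :=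
  ∀ S : Set (EuclideanSpace ℝ (Fin d)), IsCompact S →
    ∀ c : ℝ, IsKernelEigenvalue C S (c : ℂ) → c ≤ 1

end DPP

/-!
For a stationary kernel `C (x, y) = C₀ (x - y)` with `C₀ ∈ L²`, Parseval's formula applied to `C₀`
and to the autocorrelation of `f` gives `∬ conj (f x) C₀ (x - y) f y = ∫ 𝓕 C₀ · ‖𝓕 f‖ ^ 2`, while
Plancherel gives `∫ ‖f‖ ^ 2 = ∫ ‖𝓕 f‖ ^ 2`. Positive definiteness therefore means `0 ≤ 𝓕 C₀`, and
the bound of the form by `∫ ‖f‖ ^ 2` means `𝓕 C₀ ≤ 1`.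

That bound is (C2). An eigenfunction `h` on `S` with eigenvalue `c`, extended by zero, has form
`c ∫ ‖h‖ ^ 2`, which forces `c ≤ 1`. Conversely the integral operator on a compact set is compact
and positive, so its norm is an eigenvalue, hence at most one, and exhausting the space by balls
gives the bound for all `f`.

Finally `𝓕 C₀` is integrable because its integrals against `‖𝓕 f‖ ^ 2` stay below `C₀ 0` when `f`
runs through an approximate identity.
-/

namespace DPP

open Filter Topology
open scoped ComplexConjugate ContDiff Convolution

section FourierL2

section Lp

variable {α : Type*} [MeasurableSpace α] {μ : Measure α}

lemma memLp_two_of_integrable_of_norm_le {F : Type*} [NormedAddCommGroup F] {f : α → F}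
    (hf : Integrable f μ) {M : ℝ} (hM : ∀ x, ‖f x‖ ≤ M) : MemLp f 2 μ := by
  rw [memLp_two_iff_integrable_sq_norm hf.aestronglyMeasurable]
  simp only [sq]
  exact hf.norm.bdd_mul hf.aestronglyMeasurable.norm (ae_of_all _ fun x => by simpa using hM x)

lemma integral_norm_sq_eq_norm_toLp_sq {F : Type*} [NormedAddCommGroup F] {f : α → F}
    (hf : MemLp f 2 μ) : ∫ x, ‖f x‖ ^ 2 ∂μ = ‖hf.toLp f‖ ^ 2 := by
  have hnonneg : 0 ≤ ∫ x, ‖f x‖ ^ 2 ∂μ := integral_nonneg fun _ => by positivity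
  rw [Lp.norm_toLp, hf.eLpNorm_eq_integral_rpow_norm two_ne_zero ENNReal.ofNat_ne_top,
    ENNReal.toReal_ofReal (by positivity)]
  simp [← Real.sqrt_eq_rpow, ← one_div, Real.sq_sqrt hnonneg]

lemma integrable_conj {f : α → ℂ} (hf : Integrable f μ) : Integrable (fun x => conj (f x)) μ :=
  Complex.conjLIE.integrable_comp_iff.2 hf

lemma integral_mul_toLp {p : ENNReal} {f : α → ℂ} (hf : MemLp f p μ) (g : α → ℂ) :
    ∫ x, g x * hf.toLp f x ∂μ = ∫ x, g x * f x ∂μ :=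
  integral_congr_ae <| hf.coeFn_toLp.mono fun x hx => by simp only [hx]

end Lp

lemma exists_schwartzMap_apply_eq_ofReal {V : Type*} [NormedAddCommGroup V] [NormedSpace ℝ V]
    {g : V → ℝ} (hg : ContDiff ℝ ∞ g) (hgc : HasCompactSupport g) :
    ∃ G : SchwartzMap V ℂ, ∀ x, G x = (g x : ℂ) :=
  ⟨(hgc.comp_left Complex.ofReal_zero).toSchwartzMap (Complex.ofRealCLM.contDiff.comp hg),
    fun _ => rfl⟩

variable {V : Type*} [NormedAddCommGroup V] [InnerProductSpace ℝ V] [FiniteDimensional ℝ V]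
  [MeasurableSpace V] [BorelSpace V] {f g : V → ℂ}

lemma continuous_fourier_of_integrable (hf : Integrable f) : Continuous (𝓕 f) :=
  VectorFourier.fourierIntegral_continuous Real.continuous_fourierChar continuous_inner hf

lemma continuous_fourierInv_of_integrable (hf : Integrable f) : Continuous (𝓕⁻ f) := by
  rw [Real.fourierInv_eq_fourier_comp_neg]
  exact continuous_fourier_of_integrable hf.comp_neg

lemma norm_fourierInv_le_integral_norm (f : V → ℂ) (x : V) : ‖𝓕⁻ f x‖ ≤ ∫ v, ‖f v‖ := by
  rw [Real.fourierInv_eq_fourier_neg]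
  exact VectorFourier.norm_fourierIntegral_le_integral_norm _ _ _ _ _

lemma fourier_conj (f : V → ℂ) (ξ : V) : 𝓕 (fun x => conj (f x)) ξ = conj (𝓕⁻ f ξ) := by
  rw [Real.fourier_eq, Real.fourierInv_eq, ← integral_conj]
  simp [Circle.smul_def, Circle.starRingEnd_addChar]

lemma fourierInv_conj (f : V → ℂ) (ξ : V) : 𝓕⁻ (fun x => conj (f x)) ξ = conj (𝓕 f ξ) := by
  rw [Real.fourierInv_eq_fourier_neg, fourier_conj, Real.fourierInv_eq_fourier_neg, neg_neg]

lemma integral_fourier_mul_eq (hf : Integrable f) (hg : Integrable g) :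
    ∫ ξ, 𝓕 f ξ * g ξ = ∫ x, f x * 𝓕 g x := by
  simpa using! VectorFourier.integral_fourierIntegral_smul_eq_flip (L := innerₗ V)
    Real.continuous_fourierChar continuous_inner hf hg

lemma integral_fourierInv_mul_eq (hf : Integrable f) (hg : Integrable g) :
    ∫ ξ, 𝓕⁻ f ξ * g ξ = ∫ x, f x * 𝓕⁻ g x := by
  have h := integral_fourier_mul_eq hf hg.comp_neg
  rw [← integral_neg_eq_self] at h
  simpa only [neg_neg, ← Real.fourierInv_eq_fourier_neg, ← Real.fourierInv_eq_fourier_comp_neg]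
    using h

lemma ae_eq_of_forall_integral_schwartzMap_mul_eq (hf : LocallyIntegrable f)
    (hg : LocallyIntegrable g)
    (h : ∀ G : SchwartzMap V ℂ, ∫ x, G x * f x = ∫ x, G x * g x) : f =ᵐ[volume] g := by
  refine ae_eq_of_integral_contDiff_smul_eq hf hg fun q hq hqc => ?_
  obtain ⟨G, hG⟩ := exists_schwartzMap_apply_eq_ofReal hq hqc
  simpa only [hG, ← Complex.real_smul] using h G

lemma integral_schwartzMap_mul_fourier (u : Lp ℂ 2 (volume : Measure V)) (G : SchwartzMap V ℂ) :
    ∫ x, G x * (𝓕 u : Lp ℂ 2 (volume : Measure V)) x = ∫ x, 𝓕 (G : V → ℂ) x * u x := by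
  have h := congrArg (fun T => T G) (Lp.fourier_toTemperedDistribution_eq u)
  simp only [TemperedDistribution.fourier_apply, Lp.toTemperedDistribution_apply,
    smul_eq_mul] at h
  rw [← h, SchwartzMap.fourier_coe]

lemma integral_schwartzMap_mul_fourierInv (u : Lp ℂ 2 (volume : Measure V))
    (G : SchwartzMap V ℂ) :
    ∫ x, G x * (𝓕⁻ u : Lp ℂ 2 (volume : Measure V)) x = ∫ x, 𝓕⁻ (G : V → ℂ) x * u x := by
  have h := congrArg (fun T => T G) (Lp.fourierInv_toTemperedDistribution_eq u)
  simp only [TemperedDistribution.fourierInv_apply, Lp.toTemperedDistribution_apply,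
    smul_eq_mul] at h
  rw [← h, SchwartzMap.fourierInv_coe]

lemma fourier_toLp_ae_eq (hf : Integrable f) (hf2 : MemLp f 2) :
    (𝓕 (hf2.toLp f) : Lp ℂ 2 (volume : Measure V)) =ᵐ[volume] 𝓕 f :=
  ae_eq_of_forall_integral_schwartzMap_mul_eq ((Lp.memLp _).locallyIntegrable one_le_two)
    (continuous_fourier_of_integrable hf).locallyIntegrable fun G => by
      rw [integral_schwartzMap_mul_fourier, integral_mul_toLp,
        integral_fourier_mul_eq G.integrable hf]

lemma fourierInv_toLp_ae_eq (hf : Integrable f) (hf2 : MemLp f 2) :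
    (𝓕⁻ (hf2.toLp f) : Lp ℂ 2 (volume : Measure V)) =ᵐ[volume] 𝓕⁻ f :=
  ae_eq_of_forall_integral_schwartzMap_mul_eq ((Lp.memLp _).locallyIntegrable one_le_two)
    (continuous_fourierInv_of_integrable hf).locallyIntegrable fun G => by
      rw [integral_schwartzMap_mul_fourierInv, integral_mul_toLp,
        integral_fourierInv_mul_eq G.integrable hf]

lemma memLp_two_fourier (hf : Integrable f) (hf2 : MemLp f 2) : MemLp (𝓕 f) 2 :=
  (memLp_congr_ae (fourier_toLp_ae_eq hf hf2)).1 (Lp.memLp _)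

lemma memLp_two_fourierInv (hf : Integrable f) (hf2 : MemLp f 2) : MemLp (𝓕⁻ f) 2 :=
  (memLp_congr_ae (fourierInv_toLp_ae_eq hf hf2)).1 (Lp.memLp _)

lemma toLp_fourierInv_eq (hf : Integrable f) (hf2 : MemLp f 2) :
    (memLp_two_fourierInv hf hf2).toLp (𝓕⁻ f) = 𝓕⁻ (hf2.toLp f) :=
  Lp.ext ((memLp_two_fourierInv hf hf2).coeFn_toLp.trans (fourierInv_toLp_ae_eq hf hf2).symm)

lemma integral_norm_sq_fourier_eq (hf : Integrable f) (hf2 : MemLp f 2) :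
    ∫ ξ, ‖𝓕 f ξ‖ ^ 2 = ∫ x, ‖f x‖ ^ 2 := by
  rw [integral_norm_sq_eq_norm_toLp_sq hf2, ← Lp.norm_fourier_eq (hf2.toLp f),
    integral_norm_sq_eq_norm_toLp_sq (memLp_two_fourier hf hf2)]
  congr 2
  exact Lp.ext ((MemLp.coeFn_toLp _).trans (fourier_toLp_ae_eq hf hf2).symm)

/-- Parseval's formula in bilinear form; `g` is conjugated twice, hence `𝓕⁻`. -/
lemma integral_mul_eq_integral_fourier_toLp_mul (hf2 : MemLp f 2) (hg : Integrable g)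
    (hg2 : MemLp g 2) :
    ∫ x, f x * g x = ∫ ξ, (𝓕 (hf2.toLp f) : Lp ℂ 2 (volume : Measure V)) ξ * 𝓕⁻ g ξ := by
  have hgc2 : MemLp (fun x => conj (g x)) 2 := hg2.star
  have h := Lp.inner_fourier_eq (hgc2.toLp _) (hf2.toLp f)
  rw [L2.inner_def, L2.inner_def] at h
  calc ∫ x, f x * g x = ∫ x, inner ℂ (hgc2.toLp _ x) (hf2.toLp f x) := by
        refine integral_congr_ae ?_
        filter_upwards [hgc2.coeFn_toLp, hf2.coeFn_toLp] with x h₁ h₂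
        rw [h₁, h₂, RCLike.inner_apply, Complex.conj_conj]
    _ = _ := h.symm
    _ = _ := by
        refine integral_congr_ae ?_
        filter_upwards [fourier_toLp_ae_eq (integrable_conj hg) hgc2] with ξ hξ
        rw [hξ, RCLike.inner_apply, fourier_conj, Complex.conj_conj]

end FourierL2

section KernelForm

/-- The quadratic form `∬ conj (f x) K(x, y) f(y) dμ(x) dμ(y)` of the kernel `K`, as one integral
over the product space. -/
noncomputable def kernelForm {E : Type*} [MeasurableSpace E] (μ : Measure E) (K : E → E → ℂ)
    (f : E → ℂ) : ℂ :=
  ∫ p : E × E, conj (f p.1) * K p.1 p.2 * f p.2 ∂μ.prod μ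

variable {E : Type*} {K : E → E → ℂ} {M : ℝ}

lemma norm_conj_mul_kernel_mul_le (hM : ∀ x y, ‖K x y‖ ≤ M) (f : E → ℂ) (p : E × E) :
    ‖conj (f p.1) * K p.1 p.2 * f p.2‖ ≤ M * (‖f p.1‖ * ‖f p.2‖) := by
  rw [norm_mul, norm_mul, RCLike.norm_conj, mul_right_comm, mul_comm M]
  gcongr
  exact hM _ _

variable [MeasurableSpace E] {μ : Measure E} {f : E → ℂ}

lemma kernelForm_congr_ae {g : E → ℂ} (h : f =ᵐ[μ] g) :
    kernelForm μ K f = kernelForm μ K g := by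
  refine integral_congr_ae ?_
  filter_upwards [Measure.quasiMeasurePreserving_fst.ae_eq_comp h,
    Measure.quasiMeasurePreserving_snd.ae_eq_comp h] with p h₁ h₂
  simp only [Function.comp_apply] at h₁ h₂
  rw [h₁, h₂]

lemma integrable_kernelForm (hf : Integrable f μ)
    (hK : AEStronglyMeasurable (Function.uncurry K) (μ.prod μ)) (hM : ∀ x y, ‖K x y‖ ≤ M) :
    Integrable (fun p : E × E => conj (f p.1) * K p.1 p.2 * f p.2) (μ.prod μ) := by
  refine (((integrable_conj hf).mul_prod hf).bdd_mul hK
    (ae_of_all _ fun p => hM p.1 p.2)).congr (ae_of_all _ fun p => ?_)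
  simp only [Function.uncurry]
  ring

lemma norm_kernelForm_le [SFinite μ] (hf : Integrable f μ) (hM : ∀ x y, ‖K x y‖ ≤ M) :
    ‖kernelForm μ K f‖ ≤ M * (∫ x, ‖f x‖ ∂μ) ^ 2 := by
  rw [sq, ← integral_prod_mul, ← integral_const_mul]
  exact norm_integral_le_of_norm_le ((hf.norm.mul_prod hf.norm).const_mul M)
    (ae_of_all _ (norm_conj_mul_kernel_mul_le hM f))

end KernelForm

section SpectralIdentity

variable {V : Type*} [NormedAddCommGroup V] [InnerProductSpace ℝ V] [FiniteDimensional ℝ V]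
  [MeasurableSpace V] [BorelSpace V] {f : V → ℂ}

/-- The autocorrelation `u ↦ ∫ conj (f t) f(t - u) dt`, whose inverse Fourier transform is
`‖𝓕 f‖ ^ 2`. -/
noncomputable def autocorrelation (f : V → ℂ) : V → ℂ :=
  (fun x => conj (f x)) ⋆[ContinuousLinearMap.mul ℂ ℂ, volume] fun x => f (-x)

lemma autocorrelation_apply (f : V → ℂ) (u : V) :
    autocorrelation f u = ∫ t, conj (f t) * f (t - u) := by
  simp [autocorrelation, convolution_def]

lemma integrable_autocorrelation (hf : Integrable f) : Integrable (autocorrelation f) :=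
  (integrable_conj hf).integrable_convolution _ hf.comp_neg

lemma norm_autocorrelation_le (hf2 : MemLp f 2) (u : V) :
    ‖autocorrelation f u‖ ≤ ∫ x, ‖f x‖ ^ 2 := by
  have hfu : MemLp (fun x => f (x - u)) 2 :=
    hf2.comp_measurePreserving (measurePreserving_sub_right volume u)
  have hnorm : ‖hfu.toLp _‖ = ‖hf2.toLp f‖ := by
    rw [Lp.norm_toLp, Lp.norm_toLp]
    congr 1
    exact eLpNorm_comp_measurePreserving hf2.aestronglyMeasurable
      (measurePreserving_sub_right volume u)
  have hinner : autocorrelation f u = inner ℂ (hf2.toLp f) (hfu.toLp _) := by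
    rw [autocorrelation_apply, L2.inner_def]
    refine integral_congr_ae ?_
    filter_upwards [hf2.coeFn_toLp, hfu.coeFn_toLp] with x h₁ h₂
    rw [h₁, h₂, RCLike.inner_apply']
  calc ‖autocorrelation f u‖ ≤ ‖hf2.toLp f‖ * ‖hfu.toLp _‖ := by
        rw [hinner]
        exact norm_inner_le_norm _ _
    _ = ∫ x, ‖f x‖ ^ 2 := by rw [hnorm, integral_norm_sq_eq_norm_toLp_sq hf2, sq]

lemma memLp_two_autocorrelation (hf : Integrable f) (hf2 : MemLp f 2) :
    MemLp (autocorrelation f) 2 :=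
  memLp_two_of_integrable_of_norm_le (integrable_autocorrelation hf) (norm_autocorrelation_le hf2)

lemma fourierInv_autocorrelation (hf : Integrable f) (ξ : V) :
    𝓕⁻ (autocorrelation f) ξ = ((‖𝓕 f ξ‖ ^ 2 : ℝ) : ℂ) := by
  rw [Real.fourierInv_eq_fourier_neg, autocorrelation,
    Real.fourier_mul_convolution_eq (integrable_conj hf) hf.comp_neg,
    ← Real.fourierInv_eq_fourier_neg, fourierInv_conj, ← Real.fourierInv_eq_fourier_comp_neg,
    Real.fourierInv_eq_fourier_neg, neg_neg, Complex.conj_mul', Complex.ofReal_pow]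

variable {C₀ : V → ℂ} {M : ℝ}

lemma kernelForm_stationary_eq_integral_mul_autocorrelation (hC₀ : AEStronglyMeasurable C₀)
    (hM : ∀ x, ‖C₀ x‖ ≤ M) (hf : Integrable f) :
    kernelForm volume (fun x y => C₀ (x - y)) f = ∫ u, C₀ u * autocorrelation f u := by
  have hint : Integrable (fun p : V × V => C₀ p.1 * (conj (f p.2) * f (p.2 - p.1)))
      (volume.prod volume) := by
    have h := (integrable_conj hf).convolution_integrand (ContinuousLinearMap.mul ℂ ℂ) hf.comp_neg
    simpa using h.bdd_mul (hC₀.comp_fst (ν := volume)) (ae_of_all _ fun p => hM p.1)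
  have hform := integrable_kernelForm (K := fun x y => C₀ (x - y)) hf
    (hC₀.comp_quasiMeasurePreserving (quasiMeasurePreserving_sub _ _)) fun x y => hM (x - y)
  calc kernelForm volume (fun x y => C₀ (x - y)) f
      = ∫ x, ∫ y, conj (f x) * C₀ (x - y) * f y := integral_prod _ hform
    _ = ∫ x, ∫ u, C₀ u * (conj (f x) * f (x - u)) := by
        congr with x
        rw [← integral_sub_left_eq_self _ volume x]
        simp only [sub_sub_cancel]
        congr with u
        ring
    _ = ∫ u, ∫ x, C₀ u * (conj (f x) * f (x - u)) := (integral_integral_swap hint).symm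
    _ = ∫ u, C₀ u * autocorrelation f u := by
        simp only [integral_const_mul, autocorrelation_apply]

lemma kernelForm_stationary_eq_integral_fourier_mul (hL : MemLp C₀ 2) (hM : ∀ x, ‖C₀ x‖ ≤ M)
    (hf : Integrable f) (hf2 : MemLp f 2) :
    kernelForm volume (fun x y => C₀ (x - y)) f =
      ∫ ξ, (𝓕 (hL.toLp C₀) : Lp ℂ 2 (volume : Measure V)) ξ * ((‖𝓕 f ξ‖ ^ 2 : ℝ) : ℂ) := by
  rw [kernelForm_stationary_eq_integral_mul_autocorrelation hL.aestronglyMeasurable hM hf,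
    integral_mul_eq_integral_fourier_toLp_mul hL (integrable_autocorrelation hf)
      (memLp_two_autocorrelation hf hf2)]
  simp only [fourierInv_autocorrelation hf]

lemma kernelForm_stationary_eq_integral_mul_norm_fourier_sq {φ : V → ℝ} (hL : MemLp C₀ 2)
    (hφ : (𝓕 (hL.toLp C₀) : Lp ℂ 2 (volume : Measure V)) =ᵐ[volume] fun ξ => (φ ξ : ℂ))
    (hM : ∀ x, ‖C₀ x‖ ≤ M) {f : V → ℂ} (hf : Integrable f) (hf2 : MemLp f 2) :
    kernelForm volume (fun x y => C₀ (x - y)) f = ((∫ ξ, φ ξ * ‖𝓕 f ξ‖ ^ 2 : ℝ) : ℂ) := by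
  rw [kernelForm_stationary_eq_integral_fourier_mul hL hM hf hf2, ← integral_complex_ofReal]
  exact integral_congr_ae (hφ.mono fun ξ hξ => by simp only [hξ, Complex.ofReal_mul])

end SpectralIdentity

section Covariance

lemma sum_range_mul_indicator_preimage {α β R : Type*} [MeasurableSpace α]
    [NonUnitalNonAssocSemiring R] (π : SimpleFunc α β) (G : β → R) (f : α → R) (x : α) :
    ∑ b ∈ π.range, G b * (π ⁻¹' {b}).indicator f x = G (π x) * f x := by
  rw [Finset.sum_eq_single_of_mem (π x) (π.mem_range_self x)]
  · simp
  · intro b _ hb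
    simp [hb.symm]

lemma exists_simpleFunc_tendsto_id (E : Type*) [PseudoEMetricSpace E]
    [SecondCountableTopology E] [MeasurableSpace E] [OpensMeasurableSpace E] :
    ∃ π : ℕ → SimpleFunc E E, ∀ x, Tendsto (fun n => π n x) atTop (𝓝 x) := by
  rcases isEmpty_or_nonempty E with _ | ⟨⟨x₀⟩⟩
  · exact ⟨fun _ => SimpleFunc.ofIsEmpty, isEmptyElim⟩
  · exact ⟨SimpleFunc.approxOn id measurable_id Set.univ x₀ (Set.mem_univ _), fun x =>
      SimpleFunc.tendsto_approxOn measurable_id (Set.mem_univ x₀) (by simp)⟩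

lemma measurable_uncurry_comp_simpleFunc {E F : Type*} [MeasurableSpace E] [MeasurableSpace F]
    (K : E → E → F) (π : SimpleFunc E E) :
    Measurable (Function.uncurry fun x y => K (π x) (π y)) := by
  classical
  exact ((π.comp Prod.fst measurable_fst).pair
    (π.comp Prod.snd measurable_snd)).map (Function.uncurry K) |>.measurable

variable {E : Type*} {K : E → E → ℂ}

lemma IsCovarianceFunction.sum_nonneg (hK : IsCovarianceFunction K) (s : Finset E) (c : E → ℂ) :
    0 ≤ ∑ a ∈ s, ∑ b ∈ s, conj (c a) * K a b * c b := by
  have h := (Matrix.posSemidef_iff_dotProduct_mulVec.1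
    (hK s.card fun i => s.equivFin.symm i)).2 fun i => c (s.equivFin.symm i)
  simp only [dotProduct, Matrix.mulVec, kernelMatrix, Matrix.of_apply, Pi.star_apply,
    Finset.mul_sum] at h
  simp only [← Finset.sum_coe_sort s, ← s.equivFin.symm.sum_comp]
  simpa only [mul_assoc, starRingEnd_apply] using h

lemma IsCovarianceFunction.apply_self_nonneg (hK : IsCovarianceFunction K) (x : E) :
    0 ≤ K x x := by
  simpa using hK.sum_nonneg {x} 1

lemma IsCovarianceFunction.norm_sq_le (hK : IsCovarianceFunction K) (x y : E) :
    ‖K x y‖ ^ 2 ≤ (K x x).re * (K y y).re := by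
  have hdet : 0 ≤ K x x * K y y - K x y * K y x := by
    simpa [kernelMatrix, Matrix.det_fin_two] using (hK 2 ![x, y]).det_nonneg
  have hconj : conj (K x y) = K y x := (hK 2 ![x, y]).1.apply 1 0
  rw [← hconj, Complex.mul_conj', Complex.eq_re_of_ofReal_le (hK.apply_self_nonneg x),
    Complex.eq_re_of_ofReal_le (hK.apply_self_nonneg y), sub_nonneg] at hdet
  exact_mod_cast hdet

lemma IsCovarianceFunction.norm_le_of_stationary [AddGroup E] {C₀ : E → ℂ}
    (hK : IsCovarianceFunction fun x y => C₀ (x - y)) (x : E) : ‖C₀ x‖ ≤ (C₀ 0).re := by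
  have h0 : 0 ≤ C₀ 0 := by simpa using hK.apply_self_nonneg 0
  have hsq := hK.norm_sq_le x 0
  simp only [sub_zero, sub_self, ← sq] at hsq
  exact (sq_le_sq₀ (norm_nonneg _) (Complex.le_def.1 h0).1).1 hsq

variable [MeasurableSpace E] {μ : Measure E} {f : E → ℂ}

lemma kernelForm_comp_simpleFunc [SFinite μ] (K : E → E → ℂ) (π : SimpleFunc E E)
    (hf : Integrable f μ) :
    kernelForm μ (fun x y => K (π x) (π y)) f = ∑ a ∈ π.range, ∑ b ∈ π.range,
      conj (∫ x in π ⁻¹' {a}, f x ∂μ) * K a b * ∫ y in π ⁻¹' {b}, f y ∂μ := by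
  have hcell (a b : E) : Integrable (fun p : E × E => K a b *
      ((π ⁻¹' {a}).indicator (fun x => conj (f x)) p.1 * (π ⁻¹' {b}).indicator f p.2))
      (μ.prod μ) :=
    (((integrable_conj hf).indicator (π.measurableSet_preimage _)).mul_prod
      (hf.indicator (π.measurableSet_preimage _))).const_mul _
  have hsum (p : E × E) : conj (f p.1) * K (π p.1) (π p.2) * f p.2 =
      ∑ a ∈ π.range, ∑ b ∈ π.range, K a b *
        ((π ⁻¹' {a}).indicator (fun x => conj (f x)) p.1 * (π ⁻¹' {b}).indicator f p.2) := by
    simp_rw [mul_left_comm (K _ _), ← Finset.mul_sum, sum_range_mul_indicator_preimage,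
      mul_comm ((π ⁻¹' _).indicator _ _)]
    rw [sum_range_mul_indicator_preimage π fun a => K a (π p.2) * f p.2]
    ring
  simp_rw [kernelForm, hsum]
  rw [integral_finsetSum _ fun a _ => integrable_finsetSum _ fun b _ => hcell a b]
  refine Finset.sum_congr rfl fun a _ => ?_
  rw [integral_finsetSum _ fun b _ => hcell a b]
  refine Finset.sum_congr rfl fun b _ => ?_
  rw [integral_const_mul, integral_prod_mul, integral_indicator (π.measurableSet_preimage _),
    integral_indicator (π.measurableSet_preimage _), integral_conj]
  ring

variable [PseudoEMetricSpace E] [SecondCountableTopology E] [OpensMeasurableSpace E] [SFinite μ]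
  {M : ℝ}

lemma IsCovarianceFunction.kernelForm_nonneg (hK : IsCovarianceFunction K)
    (hKc : Continuous (Function.uncurry K)) (hM : ∀ x y, ‖K x y‖ ≤ M) (hf : Integrable f μ) :
    0 ≤ kernelForm μ K f := by
  obtain ⟨π, hπ⟩ := exists_simpleFunc_tendsto_id E
  have hlim : Tendsto (fun n => kernelForm μ (fun x y => K (π n x) (π n y)) f) atTop
      (𝓝 (kernelForm μ K f)) := by
    refine tendsto_integral_of_dominated_convergence (fun p => M * (‖f p.1‖ * ‖f p.2‖))
      (fun n => ?_) ((hf.norm.mul_prod hf.norm).const_mul M)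
      (fun n => ae_of_all _ (norm_conj_mul_kernel_mul_le (fun x y => hM (π n x) (π n y)) f))
      (ae_of_all _ fun p => ?_)
    · exact (integrable_kernelForm hf
        (measurable_uncurry_comp_simpleFunc K (π n)).aestronglyMeasurable
        fun x y => hM (π n x) (π n y)).aestronglyMeasurable
    · exact (((hKc.tendsto p).comp ((hπ p.1).prodMk_nhds (hπ p.2))).const_mul _).mul_const _
  refine ge_of_tendsto' hlim fun n => ?_
  rw [kernelForm_comp_simpleFunc K (π n) hf]
  exact hK.sum_nonneg _ _

end Covariance

section IntegralOperator

lemma norm_integral_mul_sq_le {α : Type*} [MeasurableSpace α] {ν : Measure α} {k f : α → ℂ}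
    (hk : MemLp k 2 ν) (hf : MemLp f 2 ν) :
    ‖∫ y, k y * f y ∂ν‖ ^ 2 ≤ (∫ y, ‖k y‖ ^ 2 ∂ν) * ∫ y, ‖f y‖ ^ 2 ∂ν := by
  have hinner : ∫ y, k y * f y ∂ν = inner ℂ (hk.star.toLp _) (hf.toLp f) := by
    rw [L2.inner_def]
    refine integral_congr_ae ?_
    filter_upwards [hk.star.coeFn_toLp, hf.coeFn_toLp] with y h₁ h₂
    rw [h₁, h₂, RCLike.inner_apply', Pi.star_apply, starRingEnd_apply, star_star]
  have hstar : ∫ y, ‖k y‖ ^ 2 ∂ν = ‖hk.star.toLp _‖ ^ 2 := by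
    simp only [← integral_norm_sq_eq_norm_toLp_sq hk.star, Pi.star_apply, norm_star]
  rw [hinner, hstar, integral_norm_sq_eq_norm_toLp_sq hf, ← mul_pow]
  gcongr
  exact norm_inner_le_norm _ _

lemma integral_mul_smul_Lp {α : Type*} [MeasurableSpace α] {ν : Measure α} (k : α → ℂ) (c : ℂ)
    (f : Lp ℂ 2 ν) : ∫ y, k y * (c • f) y ∂ν = c * ∫ y, k y * f y ∂ν := by
  rw [← integral_const_mul]
  refine integral_congr_ae ?_
  filter_upwards [Lp.coeFn_smul c f] with y hy
  rw [hy, Pi.smul_apply, smul_eq_mul, mul_left_comm]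

variable {E : Type*} [MeasurableSpace E] {μ : Measure E} [SFinite μ] {K K' : E × E → ℂ}

lemma ae_memLp_two_prodMk_left (hK : MemLp K 2 (μ.prod μ)) :
    ∀ᵐ x ∂μ, MemLp (fun y => K (x, y)) 2 μ := by
  filter_upwards [hK.aestronglyMeasurable.prodMk_left,
    hK.norm.integrable_sq.prod_right_ae] with x hm hx
  exact (memLp_two_iff_integrable_sq_norm hm).2 hx

lemma ae_integrable_kernel_mul (hK : MemLp K 2 (μ.prod μ)) (f : Lp ℂ 2 μ) :
    ∀ᵐ x ∂μ, Integrable (fun y => K (x, y) * f y) μ := by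
  filter_upwards [ae_memLp_two_prodMk_left hK] with x hx
  exact hx.integrable_mul (Lp.memLp f)

lemma ae_norm_integral_kernel_mul_sq_le (hK : MemLp K 2 (μ.prod μ)) (f : Lp ℂ 2 μ) :
    ∀ᵐ x ∂μ, ‖∫ y, K (x, y) * f y ∂μ‖ ^ 2 ≤ (∫ y, ‖K (x, y)‖ ^ 2 ∂μ) * ‖f‖ ^ 2 := by
  filter_upwards [ae_memLp_two_prodMk_left hK] with x hx
  have h := norm_integral_mul_sq_le hx (Lp.memLp f)
  rwa [integral_norm_sq_eq_norm_toLp_sq (Lp.memLp f), Lp.toLp_coeFn] at h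

lemma memLp_two_integral_kernel_mul (hK : MemLp K 2 (μ.prod μ)) (f : Lp ℂ 2 μ) :
    MemLp (fun x => ∫ y, K (x, y) * f y ∂μ) 2 μ := by
  have hm : AEStronglyMeasurable (fun x => ∫ y, K (x, y) * f y ∂μ) μ :=
    (hK.aestronglyMeasurable.mul (Lp.aestronglyMeasurable f).comp_snd).integral_prod_right'
  refine (memLp_two_iff_integrable_sq_norm hm).2 ?_
  have hK2 := hK.norm.integrable_sq
  refine (hK2.integral_prod_left.mul_const (‖f‖ ^ 2)).mono' (hm.norm.pow 2) ?_
  filter_upwards [ae_norm_integral_kernel_mul_sq_le hK f] with x hx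
  rwa [Real.norm_of_nonneg (sq_nonneg _)]

lemma norm_toLp_integral_kernel_mul_le (hK : MemLp K 2 (μ.prod μ)) (f : Lp ℂ 2 μ) :
    ‖(memLp_two_integral_kernel_mul hK f).toLp‖ ≤ ‖hK.toLp K‖ * ‖f‖ := by
  have hK2 := hK.norm.integrable_sq
  rw [← sq_le_sq₀ (by positivity) (by positivity), mul_pow, ← integral_norm_sq_eq_norm_toLp_sq,
    ← integral_norm_sq_eq_norm_toLp_sq, integral_prod _ hK2, ← integral_mul_const]
  exact integral_mono_ae (memLp_two_integral_kernel_mul hK f).norm.integrable_sq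
    (hK2.integral_prod_left.mul_const _) (ae_norm_integral_kernel_mul_sq_le hK f)

lemma integral_kernel_mul_add_ae (hK : MemLp K 2 (μ.prod μ)) (f g : Lp ℂ 2 μ) :
    (fun x => ∫ y, K (x, y) * (f + g) y ∂μ) =ᵐ[μ]
      fun x => ∫ y, K (x, y) * f y ∂μ + ∫ y, K (x, y) * g y ∂μ := by
  filter_upwards [ae_integrable_kernel_mul hK f, ae_integrable_kernel_mul hK g] with x hf hg
  rw [← integral_add hf hg]
  refine integral_congr_ae ?_
  filter_upwards [Lp.coeFn_add f g] with y hy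
  rw [hy, Pi.add_apply, mul_add]

/-- The Hilbert–Schmidt integral operator `f ↦ ∫ K(·, y) f(y) dμ(y)` on `L²(μ)`. -/
noncomputable def integralOperator (hK : MemLp K 2 (μ.prod μ)) : Lp ℂ 2 μ →L[ℂ] Lp ℂ 2 μ :=
  LinearMap.mkContinuous
    { toFun f := (memLp_two_integral_kernel_mul hK f).toLp
      map_add' f g := by
        rw [← MemLp.toLp_add, MemLp.toLp_eq_toLp_iff]
        exact integral_kernel_mul_add_ae hK f g
      map_smul' c f := by
        rw [RingHom.id_apply, ← MemLp.toLp_const_smul, MemLp.toLp_eq_toLp_iff]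
        exact ae_of_all _ fun x => integral_mul_smul_Lp (fun y => K (x, y)) c f }
    ‖hK.toLp K‖ (norm_toLp_integral_kernel_mul_le hK)

lemma coeFn_integralOperator (hK : MemLp K 2 (μ.prod μ)) (f : Lp ℂ 2 μ) :
    integralOperator hK f =ᵐ[μ] fun x => ∫ y, K (x, y) * f y ∂μ :=
  (memLp_two_integral_kernel_mul hK f).coeFn_toLp

lemma norm_integralOperator_le (hK : MemLp K 2 (μ.prod μ)) :
    ‖integralOperator hK‖ ≤ ‖hK.toLp K‖ :=
  LinearMap.mkContinuous_norm_le _ (norm_nonneg _) _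

lemma integralOperator_sub (hK : MemLp K 2 (μ.prod μ)) (hK' : MemLp K' 2 (μ.prod μ)) :
    integralOperator (hK.sub hK') = integralOperator hK - integralOperator hK' := by
  refine ContinuousLinearMap.ext fun f => Lp.ext ?_
  rw [sub_apply]
  filter_upwards [coeFn_integralOperator (hK.sub hK') f, coeFn_integralOperator hK f,
    coeFn_integralOperator hK' f, Lp.coeFn_sub (integralOperator hK f) (integralOperator hK' f),
    ae_integrable_kernel_mul hK f, ae_integrable_kernel_mul hK' f] with x h₁ h₂ h₃ h₄ h₅ h₆
  rw [h₁, h₄, Pi.sub_apply, h₂, h₃, ← integral_sub h₅ h₆]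
  simp only [Pi.sub_apply, sub_mul]

lemma inner_integralOperator_self {K : E → E → ℂ}
    (hK : MemLp (Function.uncurry K) 2 (μ.prod μ)) (f : Lp ℂ 2 μ) :
    inner ℂ f (integralOperator hK f) = kernelForm μ K f := by
  have hff : MemLp (fun p : E × E => conj (f p.1) * f p.2) 2 (μ.prod μ) := by
    have hf := (Lp.memLp f).norm.integrable_sq
    refine (memLp_two_iff_integrable_sq_norm ?_).2
      ((hf.mul_prod hf).congr (ae_of_all _ fun p => ?_))
    · exact (Lp.memLp f).star.aestronglyMeasurable.comp_fst.mul
        (Lp.aestronglyMeasurable f).comp_snd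
    · simp only [norm_mul, RCLike.norm_conj, mul_pow]
  have hint : Integrable (fun p : E × E => conj (f p.1) * K p.1 p.2 * f p.2) (μ.prod μ) := by
    refine (hff.integrable_mul hK).congr (ae_of_all _ fun p => ?_)
    simp only [Pi.mul_apply, Function.uncurry]
    ring
  rw [kernelForm, integral_prod _ hint, L2.inner_def]
  refine integral_congr_ae ?_
  filter_upwards [coeFn_integralOperator hK f] with x hx
  rw [hx, RCLike.inner_apply', ← integral_const_mul]
  simp only [mul_assoc, Function.uncurry_apply_pair]

lemma isPositive_integralOperator {K : E → E → ℂ}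
    (hK : MemLp (Function.uncurry K) 2 (μ.prod μ))
    (hpos : ∀ f : Lp ℂ 2 μ, 0 ≤ kernelForm μ K f) : (integralOperator hK).IsPositive := by
  rw [ContinuousLinearMap.isPositive_iff_complex]
  intro f
  have h := hpos f
  rw [← inner_integralOperator_self hK] at h
  have hreal : conj (inner ℂ f (integralOperator hK f)) = inner ℂ f (integralOperator hK f) :=
    Complex.conj_eq_iff_im.2 (Complex.le_def.1 h).2.symm
  rw [← inner_conj_symm, hreal]
  exact ⟨Complex.conj_eq_iff_re.1 hreal, (Complex.le_def.1 h).1⟩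

end IntegralOperator

section Compactness

lemma isCompactOperator_of_forall_mem {𝕜 F G : Type*} [NontriviallyNormedField 𝕜]
    [LocallyCompactSpace 𝕜] [NormedAddCommGroup F] [NormedSpace 𝕜 F] [NormedAddCommGroup G]
    [NormedSpace 𝕜 G]
    (T : F →L[𝕜] G) (W : Submodule 𝕜 G) [FiniteDimensional 𝕜 W] (h : ∀ x, T x ∈ W) :
    IsCompactOperator T := by
  have : ProperSpace W := FiniteDimensional.proper 𝕜 W
  exact (isCompactOperator_of_locallyCompactSpace_dom (T.codRestrict W h)).clm_comp W.subtypeL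

variable {E : Type*} [MeasurableSpace E] {μ : Measure E} [IsFiniteMeasure μ] {K : E → E → ℂ}

lemma integralOperator_comp_simpleFunc_apply (π : SimpleFunc E E)
    (hK : MemLp (Function.uncurry fun x y => K (π x) (π y)) 2 (μ.prod μ)) (f : Lp ℂ 2 μ) :
    integralOperator hK f = ∑ a ∈ π.range, (∫ y, K a (π y) * f y ∂μ) •
      indicatorConstLp 2 (π.measurableSet_preimage {a}) (measure_ne_top μ _) (1 : ℂ) := by
  have hcell : ∀ᵐ x ∂μ, ∀ a ∈ π.range, ((∫ y, K a (π y) * f y ∂μ) •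
      indicatorConstLp 2 (π.measurableSet_preimage {a}) (measure_ne_top μ _) (1 : ℂ) :
        Lp ℂ 2 μ) x = (∫ y, K a (π y) * f y ∂μ) * (π ⁻¹' {a}).indicator 1 x := by
    refine (Finset.eventually_all _).2 fun a _ => ?_
    filter_upwards [Lp.coeFn_smul (∫ y, K a (π y) * f y ∂μ) (indicatorConstLp 2
      (π.measurableSet_preimage {a}) (measure_ne_top μ _) (1 : ℂ)),
      indicatorConstLp_coeFn (p := 2) (hs := π.measurableSet_preimage {a})
        (hμs := measure_ne_top μ _) (c := (1 : ℂ))] with x h₁ h₂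
    rw [h₁, Pi.smul_apply, h₂, smul_eq_mul]
    rfl
  refine Lp.ext ?_
  filter_upwards [coeFn_integralOperator hK f, hcell, Lp.coeFn_finsetSum π.range
    fun a => (∫ y, K a (π y) * f y ∂μ) • indicatorConstLp 2 (π.measurableSet_preimage {a})
      (measure_ne_top μ _) (1 : ℂ)] with x h₁ h₂ h₃
  rw [h₁, h₃, Finset.sum_apply, Finset.sum_congr rfl h₂,
    sum_range_mul_indicator_preimage π fun a => ∫ y, K a (π y) * f y ∂μ]
  simp only [Function.uncurry_apply_pair, Pi.one_apply, mul_one]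

lemma isCompactOperator_integralOperator_comp_simpleFunc (π : SimpleFunc E E)
    (hK : MemLp (Function.uncurry fun x y => K (π x) (π y)) 2 (μ.prod μ)) :
    IsCompactOperator (integralOperator hK) := by
  let e (a : E) : Lp ℂ 2 μ :=
    indicatorConstLp 2 (π.measurableSet_preimage {a}) (measure_ne_top μ _) 1
  let W : Submodule ℂ (Lp ℂ 2 μ) := Submodule.span ℂ (e '' (π.range : Set E))
  have : FiniteDimensional ℂ W :=
    FiniteDimensional.span_of_finite ℂ (π.range.finite_toSet.image e)
  refine isCompactOperator_of_forall_mem _ W fun f => ?_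
  rw [integralOperator_comp_simpleFunc_apply π hK f]
  exact W.sum_mem fun a ha => W.smul_mem _ (Submodule.subset_span ⟨a, ha, rfl⟩)

lemma tendsto_toLp_two_of_dominated {α : Type*} [MeasurableSpace α] {ν : Measure α}
    [IsFiniteMeasure ν] {k : ℕ → α → ℂ} {l : α → ℂ} {M : ℝ} (hk : ∀ n, MemLp (k n) 2 ν)
    (hl : MemLp l 2 ν) (hkM : ∀ n x, ‖k n x‖ ≤ M) (hlM : ∀ x, ‖l x‖ ≤ M)
    (hlim : ∀ x, Tendsto (fun n => k n x) atTop (𝓝 (l x))) :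
    Tendsto (fun n => (hk n).toLp (k n)) atTop (𝓝 (hl.toLp l)) := by
  have hsq : Tendsto (fun n => ‖(hk n).toLp (k n) - hl.toLp l‖ ^ 2) atTop (𝓝 0) := by
    simp only [← MemLp.toLp_sub, ← integral_norm_sq_eq_norm_toLp_sq, Pi.sub_apply]
    rw [← integral_zero α ℝ]
    refine tendsto_integral_of_dominated_convergence (fun _ => (M + M) ^ 2)
      (fun n => ((hk n).sub hl).aestronglyMeasurable.norm.pow 2) (integrable_const _)
      (fun n => ae_of_all _ fun x => ?_) (ae_of_all _ fun x => ?_)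
    · rw [Real.norm_of_nonneg (sq_nonneg _)]
      gcongr
      exact (norm_sub_le _ _).trans (add_le_add (hkM n x) (hlM x))
    · simpa using ((hlim x).sub_const (l x)).norm.pow 2
  rw [tendsto_iff_norm_sub_tendsto_zero]
  simpa using hsq.sqrt

variable [PseudoEMetricSpace E] [SecondCountableTopology E] [OpensMeasurableSpace E] {M : ℝ}

lemma isCompactOperator_integralOperator (hKc : Continuous (Function.uncurry K))
    (hM : ∀ x y, ‖K x y‖ ≤ M) (hK : MemLp (Function.uncurry K) 2 (μ.prod μ)) :
    IsCompactOperator (integralOperator hK) := by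
  obtain ⟨π, hπ⟩ := exists_simpleFunc_tendsto_id E
  have hKπ (n : ℕ) : MemLp (Function.uncurry fun x y => K (π n x) (π n y)) 2 (μ.prod μ) :=
    MemLp.of_bound (measurable_uncurry_comp_simpleFunc K (π n)).aestronglyMeasurable M
      (ae_of_all _ fun p => hM _ _)
  have hlim : Tendsto (fun n => integralOperator (hKπ n)) atTop (𝓝 (integralOperator hK)) := by
    have h := tendsto_toLp_two_of_dominated hKπ hK (fun n p => hM _ _) (fun p => hM _ _)
      fun p => (hKc.tendsto p).comp ((hπ p.1).prodMk_nhds (hπ p.2))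
    rw [tendsto_iff_norm_sub_tendsto_zero] at h ⊢
    refine squeeze_zero (fun _ => norm_nonneg _) (fun n => ?_) h
    rw [← integralOperator_sub, ← MemLp.toLp_sub]
    exact norm_integralOperator_le _
  exact isCompactOperator_of_tendsto hlim
    (Eventually.of_forall fun n => isCompactOperator_integralOperator_comp_simpleFunc (π n) (hKπ n))

end Compactness

section EigenvalueBound

lemma hasEigenvalue_opNorm {H : Type*} [NormedAddCommGroup H] [InnerProductSpace ℂ H]
    [CompleteSpace H] {T : H →L[ℂ] H} (hc : IsCompactOperator T) (hpos : T.IsPositive)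
    (hT : T ≠ 0) : Module.End.HasEigenvalue (T : Module.End ℂ H) (‖T‖ : ℂ) := by
  have : Nontrivial H := by
    by_contra hn
    rw [not_nontrivial_iff_subsingleton] at hn
    exact hT (Subsingleton.elim _ _)
  have hspec : ‖T‖ ∈ spectrum ℝ T := CStarAlgebra.norm_mem_spectrum_of_nonneg
    ((ContinuousLinearMap.nonneg_iff_isPositive T).2 hpos)
  exact (hc.hasEigenvalue_iff_mem_spectrum (by simpa using hT)).2
    (spectrum.algebraMap_mem ℂ hspec)

lemma norm_kernelForm_le_opNorm_mul {E : Type*} [MeasurableSpace E] {μ : Measure E} [SFinite μ]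
    {K : E → E → ℂ} (hK : MemLp (Function.uncurry K) 2 (μ.prod μ)) {f : E → ℂ}
    (hf : MemLp f 2 μ) : ‖kernelForm μ K f‖ ≤ ‖integralOperator hK‖ * ∫ x, ‖f x‖ ^ 2 ∂μ := by
  rw [← kernelForm_congr_ae hf.coeFn_toLp, ← inner_integralOperator_self hK,
    integral_norm_sq_eq_norm_toLp_sq hf, sq, mul_left_comm]
  exact (norm_inner_le_norm _ _).trans (by gcongr; exact ContinuousLinearMap.le_opNorm _ _)

lemma tendsto_kernelForm_restrict_closedBall {E : Type*} [PseudoMetricSpace E] [MeasurableSpace E]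
    [OpensMeasurableSpace E] [SecondCountableTopology E] {μ : Measure E} [SFinite μ]
    {K : E → E → ℂ} {f : E → ℂ}
    (hint : Integrable (fun p : E × E => conj (f p.1) * K p.1 p.2 * f p.2) (μ.prod μ))
    (x₀ : E) :
    Tendsto (fun n : ℕ => kernelForm (μ.restrict (Metric.closedBall x₀ n)) K f) atTop
      (𝓝 (kernelForm μ K f)) := by
  have hcover : AECover (μ.prod μ) atTop fun n : ℕ => Metric.closedBall (x₀, x₀) (n : ℝ) :=
    aecover_closedBall tendsto_natCast_atTop_atTop
  simpa only [kernelForm, Measure.prod_restrict, closedBall_prod_same] using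
    hcover.integral_tendsto_of_countably_generated hint

variable {d : ℕ} {C : EuclideanSpace ℝ (Fin d) → EuclideanSpace ℝ (Fin d) → ℂ} {M : ℝ}
  {f : EuclideanSpace ℝ (Fin d) → ℂ}

lemma CondC2.norm_integralOperator_le_one (hC2 : CondC2 C) (hC1 : CondC1 C)
    (hM : ∀ x y, ‖C x y‖ ≤ M) {S : Set (EuclideanSpace ℝ (Fin d))} (hS : IsCompact S)
    (hK : MemLp (Function.uncurry C) 2 ((volume.restrict S).prod (volume.restrict S))) :
    ‖integralOperator hK‖ ≤ 1 := by
  rcases eq_or_ne (integralOperator hK) 0 with hT | hT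
  · simp [hT]
  have : IsFiniteMeasure (volume.restrict S) := isFiniteMeasure_restrict.2 hS.measure_ne_top
  have hpos : (integralOperator hK).IsPositive := isPositive_integralOperator hK fun f =>
    hC1.2.kernelForm_nonneg hC1.1 hM ((Lp.memLp f).integrable one_le_two)
  obtain ⟨v, hv⟩ := (hasEigenvalue_opNorm (isCompactOperator_integralOperator hC1.1 hM hK) hpos
    hT).exists_hasEigenvector
  refine hC2 S hS _ ⟨v, Lp.memLp v, fun h0 => hv.2 (Lp.eq_zero_iff_ae_eq_zero.2 h0), ?_⟩
  have hTv : integralOperator hK v = (‖integralOperator hK‖ : ℂ) • v := hv.apply_eq_smul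
  filter_upwards [coeFn_integralOperator hK v,
    Lp.coeFn_smul (‖integralOperator hK‖ : ℂ) v] with x h₁ h₂
  rw [← hTv, h₁, Pi.smul_apply, smul_eq_mul] at h₂
  exact h₂

lemma CondC2.norm_kernelForm_restrict_le (hC2 : CondC2 C) (hC1 : CondC1 C)
    (hM : ∀ x y, ‖C x y‖ ≤ M) {S : Set (EuclideanSpace ℝ (Fin d))} (hS : IsCompact S)
    (hf : MemLp f 2 (volume.restrict S)) :
    ‖kernelForm (volume.restrict S) C f‖ ≤ ∫ x in S, ‖f x‖ ^ 2 := by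
  have : IsFiniteMeasure (volume.restrict S) := isFiniteMeasure_restrict.2 hS.measure_ne_top
  have hK : MemLp (Function.uncurry C) 2 ((volume.restrict S).prod (volume.restrict S)) :=
    MemLp.of_bound hC1.1.aestronglyMeasurable M (ae_of_all _ fun p => hM _ _)
  exact (norm_kernelForm_le_opNorm_mul hK hf).trans (mul_le_of_le_one_left
    (integral_nonneg fun _ => sq_nonneg _) (hC2.norm_integralOperator_le_one hC1 hM hS hK))

lemma CondC2.norm_kernelForm_le (hC2 : CondC2 C) (hC1 : CondC1 C) (hM : ∀ x y, ‖C x y‖ ≤ M)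
    (hf : Integrable f) (hf2 : MemLp f 2) : ‖kernelForm volume C f‖ ≤ ∫ x, ‖f x‖ ^ 2 := by
  refine le_of_tendsto' (tendsto_kernelForm_restrict_closedBall
    (integrable_kernelForm hf hC1.1.aestronglyMeasurable hM) 0).norm fun n => ?_
  exact (hC2.norm_kernelForm_restrict_le hC1 hM (isCompact_closedBall 0 _) (hf2.restrict _)).trans
    (setIntegral_le_integral hf2.norm.integrable_sq (ae_of_all _ fun x => sq_nonneg _))

end EigenvalueBound

section NonnegTesting

lemma exists_contDiffBump_seq (V : Type*) [NormedAddCommGroup V] :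
    ∃ b : ℕ → ContDiffBump (0 : V), Tendsto (fun n => (b n).rOut) atTop (𝓝 0) ∧
      ∀ n, (b n).rOut = 2 * (b n).rIn := by
  have hpos (n : ℕ) : (0 : ℝ) < 1 / (n + 1) := Nat.one_div_pos_of_nat
  refine ⟨fun n => ⟨1 / (n + 1), 2 * (1 / (n + 1)), hpos n, by linarith [hpos n]⟩, ?_,
    fun n => rfl⟩
  simpa using (tendsto_one_div_add_atTop_nhds_zero_nat (𝕜 := ℝ)).const_mul 2

variable {V : Type*} [NormedAddCommGroup V] [NormedSpace ℝ V]
  [FiniteDimensional ℝ V]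

/-- A square root of a smooth `ψ ≥ 0` need not be smooth, but `√(ψ + ε)` is; the cutoff `χ` makes it
compactly supported. -/
lemma exists_sq_eq_add_const_mul_sq {ψ : V → ℝ} (hψ : ContDiff ℝ ∞ ψ)
    (hψc : HasCompactSupport ψ) (hψ0 : ∀ x, 0 ≤ ψ x) :
    ∃ χ : V → ℝ, ContDiff ℝ ∞ χ ∧ HasCompactSupport χ ∧ ∀ ε > 0, ∃ g : V → ℝ, ContDiff ℝ ∞ g ∧
      HasCompactSupport g ∧ ∀ x, g x ^ 2 = ψ x + ε * χ x ^ 2 := by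
  obtain ⟨r, hr⟩ := hψc.isCompact.isBounded.subset_closedBall 0
  let χ : ContDiffBump (0 : V) :=
    ⟨max r 1, max r 1 + 1, lt_max_of_lt_right one_pos, lt_add_one _⟩
  have hχ (x : V) (hx : ψ x ≠ 0) : χ x = 1 := χ.one_of_mem_closedBall
    (Metric.closedBall_subset_closedBall (le_max_left r 1) (hr (subset_tsupport ψ hx)))
  refine ⟨χ, χ.contDiff, χ.hasCompactSupport, fun ε hε => ⟨fun x => √(ψ x + ε) * χ x, ?_, ?_,
    fun x => ?_⟩⟩
  · exact ((hψ.add contDiff_const).sqrt fun x =>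
      (add_pos_of_nonneg_of_pos (hψ0 x) hε).ne').mul χ.contDiff
  · exact χ.hasCompactSupport.mul_left
  · rw [mul_pow, Real.sq_sqrt (by linarith [hψ0 x])]
    rcases eq_or_ne (ψ x) 0 with hx | hx
    · rw [hx, zero_add, zero_add]
    · rw [hχ x hx]
      ring

variable [MeasurableSpace V] [BorelSpace V] {μ : Measure V} {Φ : V → ℂ}

lemma integral_smul_nonneg_of_forall_sq (hΦ : LocallyIntegrable Φ μ)
    (h : ∀ g : V → ℝ, ContDiff ℝ ∞ g → HasCompactSupport g → 0 ≤ ∫ x, g x ^ 2 • Φ x ∂μ)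
    {ψ : V → ℝ} (hψ : ContDiff ℝ ∞ ψ) (hψc : HasCompactSupport ψ) (hψ0 : ∀ x, 0 ≤ ψ x) :
    0 ≤ ∫ x, ψ x • Φ x ∂μ := by
  obtain ⟨χ, hχ, hχc, hsq⟩ := exists_sq_eq_add_const_mul_sq hψ hψc hψ0
  have hψi : Integrable (fun x => ψ x • Φ x) μ :=
    hΦ.integrable_smul_left_of_hasCompactSupport hψ.continuous hψc
  have hχi : Integrable (fun x => χ x ^ 2 • Φ x) μ :=
    hΦ.integrable_smul_left_of_hasCompactSupport (hχ.continuous.pow 2)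
      (hχc.comp_left (g := (· ^ 2)) (zero_pow two_ne_zero))
  have hlim : Tendsto (fun ε : ℝ => ∫ x, ψ x • Φ x ∂μ + ε • ∫ x, χ x ^ 2 • Φ x ∂μ) (𝓝[>] 0)
      (𝓝 (∫ x, ψ x • Φ x ∂μ)) := by
    have h0 : Continuous fun ε : ℝ => ∫ x, ψ x • Φ x ∂μ + ε • ∫ x, χ x ^ 2 • Φ x ∂μ := by
      fun_prop
    simpa using (h0.tendsto 0).mono_left nhdsWithin_le_nhds
  refine ge_of_tendsto hlim (eventually_mem_nhdsWithin.mono fun ε hε => ?_)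
  obtain ⟨g, hg, hgc, hgε⟩ := hsq ε hε
  have hεχi : Integrable (fun x => ε • χ x ^ 2 • Φ x) μ := hχi.smul ε
  rw [← integral_smul, ← integral_add hψi hεχi]
  simpa only [hgε, add_smul, mul_smul] using h g hg hgc

lemma ae_nonneg_of_forall_integral_sq_smul_nonneg [μ.IsAddHaarMeasure]
    (hΦ : LocallyIntegrable Φ μ)
    (h : ∀ g : V → ℝ, ContDiff ℝ ∞ g → HasCompactSupport g → 0 ≤ ∫ x, g x ^ 2 • Φ x ∂μ) :
    ∀ᵐ x ∂μ, 0 ≤ Φ x := by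
  obtain ⟨b, hb, hb2⟩ := exists_contDiffBump_seq V
  filter_upwards [ContDiffBump.ae_convolution_tendsto_right_of_locallyIntegrable hb
    (Eventually.of_forall fun n => (hb2 n).le) hΦ] with x hx
  refine ge_of_tendsto' hx fun n => ?_
  rw [convolution_eq_swap]
  exact integral_smul_nonneg_of_forall_sq hΦ h
    ((b n).contDiff_normed.comp (contDiff_const.sub contDiff_id))
    ((b n).hasCompactSupport_normed.comp_homeomorph (Homeomorph.subLeft x))
    fun t => (b n).nonneg_normed _

end NonnegTesting

section SpectralMass

variable {V : Type*} [NormedAddCommGroup V] [InnerProductSpace ℝ V] [FiniteDimensional ℝ V]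
  [MeasurableSpace V] [BorelSpace V]

lemma tendsto_fourier_contDiffBump_normed {b : ℕ → ContDiffBump (0 : V)}
    (hb : Tendsto (fun n => (b n).rOut) atTop (𝓝 0)) (ξ : V) :
    Tendsto (fun n => 𝓕 (fun x => ((b n).normed volume x : ℂ)) ξ) atTop (𝓝 1) := by
  have hc : Continuous fun x : V => (Real.fourierChar (inner ℝ x ξ) : ℂ) := by fun_prop
  have h := ContDiffBump.convolution_tendsto_right_of_continuous (μ := volume) hb hc 0
  simp only [inner_zero_left, AddChar.map_zero_eq_one, Circle.coe_one] at h
  refine h.congr fun n => ?_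
  rw [convolution_def, Real.fourier_eq]
  congr with x
  simp [Circle.smul_def, mul_comm]

lemma integrable_of_forall_integral_mul_norm_fourier_sq_le {φ : V → ℝ} {M : ℝ}
    (hφm : AEStronglyMeasurable φ) (hφ0 : ∀ x, 0 ≤ φ x)
    (hM : ∀ f : V → ℂ, Continuous f → HasCompactSupport f → ∫ x, ‖f x‖ = 1 →
      Integrable (fun ξ => φ ξ * ‖𝓕 f ξ‖ ^ 2) ∧ ∫ ξ, φ ξ * ‖𝓕 f ξ‖ ^ 2 ≤ M) :
    Integrable φ := by
  obtain ⟨b, hb, -⟩ := exists_contDiffBump_seq V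
  let f (n : ℕ) (x : V) : ℂ := (b n).normed volume x
  have hbound (n : ℕ) := hM (f n) (Complex.continuous_ofReal.comp (b n).continuous_normed)
    ((b n).hasCompactSupport_normed.comp_left Complex.ofReal_zero) (by
      simp only [f, Complex.norm_real, Real.norm_of_nonneg ((b n).nonneg_normed _)]
      exact (b n).integral_normed)
  have hlim (ξ : V) : Tendsto (fun n => ENNReal.ofReal (φ ξ * ‖𝓕 (f n) ξ‖ ^ 2)) atTop
      (𝓝 (ENNReal.ofReal (φ ξ))) := by
    refine ENNReal.tendsto_ofReal ?_
    simpa using ((tendsto_fourier_contDiffBump_normed hb ξ).norm.pow 2).const_mul (φ ξ)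
  refine ⟨hφm, (hasFiniteIntegral_iff_ofReal (ae_of_all _ hφ0)).2 ?_⟩
  calc ∫⁻ ξ, ENNReal.ofReal (φ ξ)
      = ∫⁻ ξ, liminf (fun n => ENNReal.ofReal (φ ξ * ‖𝓕 (f n) ξ‖ ^ 2)) atTop := by
        simp_rw [fun ξ => (hlim ξ).liminf_eq]
    _ ≤ liminf (fun n => ∫⁻ ξ, ENNReal.ofReal (φ ξ * ‖𝓕 (f n) ξ‖ ^ 2)) atTop :=
        lintegral_liminf_le' fun n => (hbound n).1.aemeasurable.ennreal_ofReal
    _ ≤ ENNReal.ofReal M := by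
        refine liminf_le_of_frequently_le' (Frequently.of_forall fun n => ?_)
        rw [← ofReal_integral_eq_lintegral_ofReal (hbound n).1
          (ae_of_all _ fun ξ => mul_nonneg (hφ0 ξ) (sq_nonneg _))]
        exact ENNReal.ofReal_le_ofReal (hbound n).2
    _ < ⊤ := ENNReal.ofReal_lt_top

end SpectralMass

section Sufficiency

lemma fourierChar_inner_sub {V : Type*} [NormedAddCommGroup V] [InnerProductSpace ℝ V]
    (v x y : V) : (Real.fourierChar (inner ℝ v (x - y)) : ℂ) =
      Real.fourierChar (inner ℝ v x) * conj (Real.fourierChar (inner ℝ v y) : ℂ) := by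
  rw [inner_sub_right, AddChar.map_sub_eq_div, Circle.coe_div, div_eq_mul_inv,
    ← Circle.coe_inv, Circle.coe_inv_eq_conj]

section PositiveDefinite

variable {V : Type*} [NormedAddCommGroup V] [InnerProductSpace ℝ V] [FiniteDimensional ℝ V]
  [MeasurableSpace V] [BorelSpace V] {φ : V → ℝ}

lemma conj_fourierInv_ofReal (φ : V → ℝ) (x : V) :
    conj (𝓕⁻ (fun v => (φ v : ℂ)) x) = 𝓕⁻ (fun v => (φ v : ℂ)) (-x) := by
  rw [← fourier_conj]
  simp only [Complex.conj_ofReal, Real.fourierInv_eq_fourier_neg, neg_neg]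

lemma sum_conj_mul_fourierInv_sub_mul (hφ : Integrable φ) {n : ℕ} (x : Fin n → V)
    (c : Fin n → ℂ) :
    ∑ i, ∑ j, conj (c i) * 𝓕⁻ (fun v => (φ v : ℂ)) (x i - x j) * c j =
      ((∫ v, φ v * ‖∑ i, conj (c i) * Real.fourierChar (inner ℝ v (x i))‖ ^ 2 : ℝ) : ℂ) := by
  have hint (i j : Fin n) : Integrable fun v =>
      conj (c i) * ((Real.fourierChar (inner ℝ v (x i - x j)) : ℂ) * (φ v : ℂ)) * c j := by
    have hcont : Continuous fun v : V => (Real.fourierChar (inner ℝ v (x i - x j)) : ℂ) := by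
      fun_prop
    exact ((hφ.ofReal.bdd_mul hcont.aestronglyMeasurable
      (ae_of_all _ fun v => (Circle.norm_coe _).le)).const_mul _).mul_const _
  simp only [Real.fourierInv_eq, Circle.smul_def, smul_eq_mul, ← integral_const_mul,
    ← integral_mul_const]
  simp_rw [← integral_finsetSum _ fun j _ => hint _ j]
  rw [← integral_finsetSum _ fun i _ => integrable_finsetSum _ fun j _ => hint i j,
    ← integral_complex_ofReal]
  congr with v
  simp only [Complex.ofReal_mul, Complex.ofReal_pow, ← Complex.mul_conj', map_sum, map_mul,
    Complex.conj_conj, fourierChar_inner_sub]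
  simp_rw [Finset.sum_mul_sum, Finset.mul_sum]
  congr! 2 with i _ j _
  ring

lemma isCovarianceFunction_fourierInv (hφ : Integrable φ) (hφ0 : ∀ x, 0 ≤ φ x) :
    IsCovarianceFunction fun x y => 𝓕⁻ (fun v => (φ v : ℂ)) (x - y) := by
  intro n x
  rw [Matrix.posSemidef_iff_dotProduct_mulVec]
  refine ⟨?_, fun c => ?_⟩
  · ext i j
    simp only [kernelMatrix, Matrix.conjTranspose_apply, Matrix.of_apply, ← starRingEnd_apply,
      conj_fourierInv_ofReal, neg_sub]
  · have h := sum_conj_mul_fourierInv_sub_mul hφ x c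
    simp only [dotProduct, Matrix.mulVec, kernelMatrix, Matrix.of_apply, Pi.star_apply,
      ← starRingEnd_apply, Finset.mul_sum, ← mul_assoc, h]
    exact Complex.zero_le_real.2 (integral_nonneg fun v => mul_nonneg (hφ0 v) (sq_nonneg _))

lemma kernelForm_fourierInv (hφ : Integrable φ) (hφ2 : MemLp (fun v => (φ v : ℂ)) 2)
    {f : V → ℂ} (hf : Integrable f) (hf2 : MemLp f 2) :
    kernelForm volume (fun x y => 𝓕⁻ (fun v => (φ v : ℂ)) (x - y)) f =
      ((∫ ξ, φ ξ * ‖𝓕 f ξ‖ ^ 2 : ℝ) : ℂ) := by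
  refine kernelForm_stationary_eq_integral_mul_norm_fourier_sq
    (memLp_two_fourierInv hφ.ofReal hφ2) ?_ (norm_fourierInv_le_integral_norm _) hf hf2
  rw [toLp_fourierInv_eq hφ.ofReal hφ2, FourierTransform.fourier_fourierInv_eq]
  exact hφ2.coeFn_toLp

end PositiveDefinite

lemma kernelForm_indicator {E : Type*} [MeasurableSpace E] {μ : Measure E} [SFinite μ]
    (K : E → E → ℂ) (f : E → ℂ) {S : Set E} (hS : MeasurableSet S) :
    kernelForm μ K (S.indicator f) = kernelForm (μ.restrict S) K f := by
  rw [kernelForm, kernelForm, Measure.prod_restrict, ← integral_indicator (hS.prod hS)]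
  congr with p
  by_cases h₁ : p.1 ∈ S <;> by_cases h₂ : p.2 ∈ S <;> simp [h₁, h₂]

lemma kernelForm_eq_mul_integral_norm_sq_of_eigenfunction {E : Type*} [MeasurableSpace E]
    {μ : Measure E} [SFinite μ] {K : E → E → ℂ} {M : ℝ} {c : ℂ} {f : E → ℂ}
    (hK : AEStronglyMeasurable (Function.uncurry K) (μ.prod μ)) (hM : ∀ x y, ‖K x y‖ ≤ M)
    (hf : Integrable f μ) (heig : ∀ᵐ x ∂μ, ∫ y, K x y * f y ∂μ = c * f x) :
    kernelForm μ K f = c * ((∫ x, ‖f x‖ ^ 2 ∂μ : ℝ) : ℂ) := by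
  rw [kernelForm, integral_prod _ (integrable_kernelForm hf hK hM), ← integral_complex_ofReal,
    ← integral_const_mul]
  refine integral_congr_ae ?_
  filter_upwards [heig] with x hx
  simp only [mul_assoc, integral_const_mul, hx, Complex.ofReal_pow, ← Complex.conj_mul']
  ring

lemma integral_norm_sq_pos {α F : Type*} [MeasurableSpace α] {μ : Measure α}
    [NormedAddCommGroup F] {f : α → F} (hf : MemLp f 2 μ) (h : ¬ ∀ᵐ x ∂μ, f x = 0) :
    0 < ∫ x, ‖f x‖ ^ 2 ∂μ := by
  refine (integral_nonneg fun x => sq_nonneg _).lt_of_ne' fun h0 => h ?_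
  filter_upwards [(integral_eq_zero_iff_of_nonneg (fun x => sq_nonneg ‖f x‖)
    hf.norm.integrable_sq).1 h0] with x hx
  simpa using hx

variable {d : ℕ}

lemma condC2_of_forall_re_kernelForm_le
    {C : EuclideanSpace ℝ (Fin d) → EuclideanSpace ℝ (Fin d) → ℂ} {M : ℝ}
    (hC : Continuous (Function.uncurry C)) (hM : ∀ x y, ‖C x y‖ ≤ M)
    (h : ∀ f, Integrable f → MemLp f 2 → (kernelForm volume C f).re ≤ ∫ x, ‖f x‖ ^ 2) :
    CondC2 C := by
  rintro S hS c ⟨f, hf, hne, heig⟩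
  have : IsFiniteMeasure (volume.restrict S) := ⟨by simpa using hS.measure_lt_top⟩
  have hfi : Integrable f (volume.restrict S) := hf.integrable one_le_two
  have hle := h (S.indicator f) ((integrable_indicator_iff hS.measurableSet).2 hfi)
    ((memLp_indicator_iff_restrict hS.measurableSet).2 hf)
  have hnorm : ∫ x, ‖S.indicator f x‖ ^ 2 = ∫ x in S, ‖f x‖ ^ 2 := by
    rw [← integral_indicator hS.measurableSet]
    congr with x
    by_cases hx : x ∈ S <;> simp [hx]
  rw [kernelForm_indicator C f hS.measurableSet,
    kernelForm_eq_mul_integral_norm_sq_of_eigenfunction hC.aestronglyMeasurable hM hfi heig,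
    Complex.re_ofReal_mul, Complex.ofReal_re, hnorm] at hle
  exact le_of_mul_le_mul_right (by simpa using hle) (integral_norm_sq_pos hf hne)

lemma condC2_fourierInv {φ : EuclideanSpace ℝ (Fin d) → ℝ} (hφ : Integrable φ)
    (hφ2 : MemLp (fun v => (φ v : ℂ)) 2) (hφ1 : ∀ x, 0 ≤ φ x ∧ φ x ≤ 1) :
    CondC2 fun x y => 𝓕⁻ (fun v => (φ v : ℂ)) (x - y) := by
  refine condC2_of_forall_re_kernelForm_le
    ((continuous_fourierInv_of_integrable hφ.ofReal).comp continuous_sub)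
    (fun x y => norm_fourierInv_le_integral_norm _ (x - y)) fun f hf hf2 => ?_
  have hF := memLp_two_fourier hf hf2
  rw [kernelForm_fourierInv hφ hφ2 hf hf2, Complex.ofReal_re, ← integral_norm_sq_fourier_eq hf hf2]
  exact integral_mono_of_nonneg (ae_of_all _ fun ξ => mul_nonneg (hφ1 ξ).1 (sq_nonneg _))
    hF.norm.integrable_sq (ae_of_all _ fun ξ => mul_le_of_le_one_left (sq_nonneg _) (hφ1 ξ).2)

end Sufficiency

section Necessity

lemma exists_unitInterval_ae_eq {α : Type*} [MeasurableSpace α] {μ : Measure α} {Φ : α → ℂ}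
    (hΦ : AEStronglyMeasurable Φ μ) (h0 : ∀ᵐ x ∂μ, 0 ≤ Φ x) (h1 : ∀ᵐ x ∂μ, Φ x ≤ 1) :
    ∃ φ : α → ℝ, AEStronglyMeasurable φ μ ∧ (∀ x, 0 ≤ φ x ∧ φ x ≤ 1) ∧
      Φ =ᵐ[μ] fun x => (φ x : ℂ) := by
  refine ⟨fun x => Set.projIcc 0 1 zero_le_one (Φ x).re, ?_,
    fun x => (Set.projIcc (0 : ℝ) 1 zero_le_one (Φ x).re).2, ?_⟩
  · exact (continuous_subtype_val.comp
      (continuous_projIcc.comp Complex.continuous_re)).comp_aestronglyMeasurable hΦ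
  · filter_upwards [h0, h1] with x hx0 hx1
    rw [Set.projIcc_of_mem zero_le_one ⟨(Complex.le_def.1 hx0).1, (Complex.le_def.1 hx1).1⟩]
    exact Complex.ext rfl (Complex.le_def.1 hx0).2.symm

variable {V : Type*} [NormedAddCommGroup V] [InnerProductSpace ℝ V] [FiniteDimensional ℝ V]
  [MeasurableSpace V] [BorelSpace V] {C₀ : V → ℂ} {M : ℝ}

lemma exists_fourier_eq_ofReal {g : V → ℝ} (hg : ContDiff ℝ ∞ g) (hgc : HasCompactSupport g) :
    ∃ f : V → ℂ, Integrable f ∧ MemLp f 2 ∧ ∀ ξ, 𝓕 f ξ = g ξ := by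
  obtain ⟨G, hG⟩ := exists_schwartzMap_apply_eq_ofReal hg hgc
  refine ⟨(𝓕⁻ G : SchwartzMap V ℂ), (𝓕⁻ G).integrable, (𝓕⁻ G).memLp 2, fun ξ => ?_⟩
  rw [← SchwartzMap.fourier_coe, FourierTransform.fourier_fourierInv_eq, hG]

lemma exists_integral_sq_smul_fourier_eq_kernelForm (hL : MemLp C₀ 2) (hM : ∀ x, ‖C₀ x‖ ≤ M)
    {g : V → ℝ} (hg : ContDiff ℝ ∞ g) (hgc : HasCompactSupport g) :
    ∃ f : V → ℂ, Integrable f ∧ MemLp f 2 ∧ ∫ ξ, g ξ ^ 2 = ∫ x, ‖f x‖ ^ 2 ∧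
      ∫ ξ, g ξ ^ 2 • (𝓕 (hL.toLp C₀) : Lp ℂ 2 (volume : Measure V)) ξ =
        kernelForm volume (fun x y => C₀ (x - y)) f := by
  obtain ⟨f, hf, hf2, hfg⟩ := exists_fourier_eq_ofReal hg hgc
  have hsq (ξ : V) : ‖𝓕 f ξ‖ ^ 2 = g ξ ^ 2 := by
    rw [hfg, Complex.norm_real, Real.norm_eq_abs, sq_abs]
  refine ⟨f, hf, hf2, ?_, ?_⟩
  · rw [← integral_norm_sq_fourier_eq hf hf2]
    simp only [hsq]
  · rw [kernelForm_stationary_eq_integral_fourier_mul hL hM hf hf2]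
    simp only [hsq, Complex.real_smul, mul_comm]

lemma ae_nonneg_fourier_toLp (hL : MemLp C₀ 2) (hM : ∀ x, ‖C₀ x‖ ≤ M)
    (hpos : ∀ f, Integrable f → MemLp f 2 → 0 ≤ kernelForm volume (fun x y => C₀ (x - y)) f) :
    ∀ᵐ ξ, 0 ≤ (𝓕 (hL.toLp C₀) : Lp ℂ 2 (volume : Measure V)) ξ := by
  refine ae_nonneg_of_forall_integral_sq_smul_nonneg ((Lp.memLp _).locallyIntegrable one_le_two)
    fun g hg hgc => ?_
  obtain ⟨f, hf, hf2, -, hgf⟩ := exists_integral_sq_smul_fourier_eq_kernelForm hL hM hg hgc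
  exact hgf ▸ hpos f hf hf2

lemma ae_fourier_toLp_le_one (hL : MemLp C₀ 2) (hM : ∀ x, ‖C₀ x‖ ≤ M)
    (hle : ∀ f, Integrable f → MemLp f 2 →
      kernelForm volume (fun x y => C₀ (x - y)) f ≤ ((∫ x, ‖f x‖ ^ 2 : ℝ) : ℂ)) :
    ∀ᵐ ξ, (𝓕 (hL.toLp C₀) : Lp ℂ 2 (volume : Measure V)) ξ ≤ 1 := by
  have hΦ : LocallyIntegrable (𝓕 (hL.toLp C₀) : Lp ℂ 2 (volume : Measure V)) :=
    (Lp.memLp _).locallyIntegrable one_le_two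
  have hΦ1 := (locallyIntegrable_const (1 : ℂ) (μ := (volume : Measure V))).sub hΦ
  refine (ae_nonneg_of_forall_integral_sq_smul_nonneg hΦ1 fun g hg hgc => ?_).mono
    fun ξ hξ => sub_nonneg.1 hξ
  obtain ⟨f, hf, hf2, hg2, hgf⟩ := exists_integral_sq_smul_fourier_eq_kernelForm hL hM hg hgc
  have hgc2 : HasCompactSupport fun x => g x ^ 2 :=
    hgc.comp_left (g := (· ^ 2)) (zero_pow two_ne_zero)
  have hint {Ψ : V → ℂ} (hΨ : LocallyIntegrable Ψ) : Integrable fun ξ => g ξ ^ 2 • Ψ ξ :=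
    hΨ.integrable_smul_left_of_hasCompactSupport (hg.continuous.pow 2) hgc2
  simp only [Pi.sub_apply, smul_sub]
  rw [integral_sub (hint (locallyIntegrable_const 1)) (hint hΦ), hgf, sub_nonneg,
    integral_smul_const, hg2, Complex.real_smul, mul_one]
  exact hle f hf hf2

lemma integrable_of_fourier_toLp_ae_eq {φ : V → ℝ} (hL : MemLp C₀ 2) (hM : ∀ x, ‖C₀ x‖ ≤ M)
    (hφm : AEStronglyMeasurable φ) (hφ1 : ∀ x, 0 ≤ φ x ∧ φ x ≤ 1)
    (hφ : (𝓕 (hL.toLp C₀) : Lp ℂ 2 (volume : Measure V)) =ᵐ[volume] fun ξ => (φ ξ : ℂ)) :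
    Integrable φ := by
  refine integrable_of_forall_integral_mul_norm_fourier_sq_le (M := M) hφm
    (fun x => (hφ1 x).1) fun f hfc hfs hf1 => ?_
  have hf : Integrable f := hfc.integrable_of_hasCompactSupport hfs
  have hf2 : MemLp f 2 := hfc.memLp_of_hasCompactSupport hfs
  have hF := memLp_two_fourier hf hf2
  refine ⟨hF.norm.integrable_sq.bdd_mul (c := 1) hφm (ae_of_all _ fun ξ => ?_), ?_⟩
  · rw [Real.norm_of_nonneg (hφ1 ξ).1]
    exact (hφ1 ξ).2
  · have h := norm_kernelForm_le hf fun x y => hM (x - y)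
    rw [kernelForm_stationary_eq_integral_mul_norm_fourier_sq hL hφ hM hf hf2, hf1, one_pow,
      mul_one, Complex.norm_real] at h
    exact (Real.le_norm_self _).trans h

lemma eq_fourierInv_of_fourier_toLp_ae_eq {f : V → ℂ} (hC₀ : Continuous C₀) (hL : MemLp C₀ 2)
    (hf : Integrable f)
    (h : (𝓕 (hL.toLp C₀) : Lp ℂ 2 (volume : Measure V)) =ᵐ[volume] f) : C₀ = 𝓕⁻ f := by
  have hf2 : MemLp f 2 := (memLp_congr_ae h).1 (Lp.memLp _)
  have htoLp : hf2.toLp f = 𝓕 (hL.toLp C₀) := Lp.ext (hf2.coeFn_toLp.trans h.symm)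
  have hinv := fourierInv_toLp_ae_eq hf hf2
  rw [htoLp, FourierTransform.fourierInv_fourier_eq] at hinv
  exact (hC₀.ae_eq_iff_eq volume (continuous_fourierInv_of_integrable hf)).1
    (hL.coeFn_toLp.symm.trans hinv)

lemma exists_spectralDensity {d : ℕ} {C₀ : EuclideanSpace ℝ (Fin d) → ℂ}
    (hC1 : CondC1 fun x y => C₀ (x - y)) (hC2 : CondC2 fun x y => C₀ (x - y))
    (hL : MemLp C₀ 2) :
    ∃ φ : EuclideanSpace ℝ (Fin d) → ℝ, Integrable φ ∧ (∀ x, 0 ≤ φ x ∧ φ x ≤ 1) ∧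
      C₀ = 𝓕⁻ (fun x => (φ x : ℂ)) := by
  have hM := hC1.2.norm_le_of_stationary
  have hC₀ : Continuous C₀ := by
    simpa [Function.comp_def] using hC1.1.comp (.prodMk_left 0)
  have hpos (f) (hf : Integrable f) := hC1.2.kernelForm_nonneg hC1.1 (fun x y => hM (x - y)) hf
  have h0 := ae_nonneg_fourier_toLp hL hM fun f hf _ => hpos f hf
  have h1 := ae_fourier_toLp_le_one hL hM fun f hf hf2 => by
    rw [Complex.eq_coe_norm_of_nonneg (hpos f hf)]
    exact_mod_cast hC2.norm_kernelForm_le hC1 (fun x y => hM (x - y)) hf hf2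
  obtain ⟨φ, hφm, hφ1, hφ⟩ := exists_unitInterval_ae_eq (Lp.aestronglyMeasurable _) h0 h1
  have hφi := integrable_of_fourier_toLp_ae_eq hL hM hφm hφ1 hφ
  exact ⟨φ, hφi, hφ1, eq_fourierInv_of_fourier_toLp_ae_eq hC₀ hL hφi.ofReal hφ⟩

end Necessity

end DPP

theorem corollary3p2 {d : ℕ}
    (C : EuclideanSpace ℝ (Fin d) → EuclideanSpace ℝ (Fin d) → ℂ)
    (C₀ : EuclideanSpace ℝ (Fin d) → ℂ)
    (hstat : ∀ x y, C x y = C₀ (x - y)) :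
    (∃ φ : EuclideanSpace ℝ (Fin d) → ℝ,
        Integrable φ volume ∧ (∀ x, 0 ≤ φ x ∧ φ x ≤ 1) ∧
        C₀ = 𝓕⁻ (fun x => (φ x : ℂ))) ↔
      (DPP.CondC1 C ∧ DPP.CondC2 C ∧ MemLp C₀ 2 volume) := by
  obtain rfl : C = fun x y => C₀ (x - y) := funext₂ hstat
  constructor
  · rintro ⟨φ, hφ, hφ1, rfl⟩
    have hφ2 : MemLp (fun x => (φ x : ℂ)) 2 volume :=
      DPP.memLp_two_of_integrable_of_norm_le (M := 1) hφ.ofReal fun x => by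
        rw [Complex.norm_real, Real.norm_of_nonneg (hφ1 x).1]
        exact (hφ1 x).2
    exact ⟨⟨(DPP.continuous_fourierInv_of_integrable hφ.ofReal).comp continuous_sub,
        DPP.isCovarianceFunction_fourierInv hφ fun x => (hφ1 x).1⟩,
      DPP.condC2_fourierInv hφ hφ2 hφ1, DPP.memLp_two_fourierInv hφ.ofReal hφ2⟩
  · rintro ⟨hC1, hC2, hL⟩
    exact DPP.exists_spectralDensity hC1 hC2 hL
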